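/- Let $N\ge 2$. A real discrete Sturm–Liouville equation $$-\nabla(f_n\Delta y_n)+q_ny_n=\lambda w_ny_n,\qquad 1\le n\le N,$$ with $\Delta y_n=y_{n+1}-y_n$, $\nabla y_n=y_n-y_{n-1}$, is identified with the point $(1/f,q,w)=(1/f_0,\dots,1/f_N,q_1,\dots,q_N,w_1,\dots,w_N)\in\mathbb R^{3N+1}$; let $\Omega_N^{\mathbb R,+}\subset\mathbb R^{3N+1}$ be the set of those with $f_n\ne 0$ $(0\le n\le N)$ and $w_n>0$ $(1\le n\le N)$. Fix a self-adjoint boundary condition $$A\begin{pmatrix}y_0\\ f_0\Delta y_0\end{pmatrix}+B\begin{pmatrix}y_N\\ f_N\Delta y_N\end{pmatrix}=0,$$ that is, $A,B\in\mathbb C^{2\times 2}$ with $\operatorname{rank}(A,B)=2$ and $AEA^*=BEB^*$, where $E=\begin{pmatrix}0&1\\-1&0\end{pmatrix}$. A number $\lambda$ is an eigenvalue if the equation together with the boundary condition has a solution $(y_0,\dots,y_{N+1})\in\mathbb C^{N+2}$, $y\neq 0$. A continuous eigenvalue branch over $\Omega_N^{\mathbb R,+}$ is a continuous function $\Lambda:\mathcal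 D\to\mathbb R$ on a nonempty connected open set $\mathcal D\subset\Omega_N^{\mathbb R,+}$ such that $\Lambda(\omega)$ is an eigenvalue for the equation $\omega$, for every $\omega\in\mathcal D$. Then for each continuous eigenvalue branch $\Lambda:\mathcal D\to\mathbb R$ the following hold, where monotonicity is not necessarily strict and a statement about a coordinate direction means that it holds along every interval, contained in $\mathcal D$, of a line parallel to that coordinate axis: 1. $\Lambda$ is decreasing in every $(1/f_n)$-direction with $0\le n\le N-1$; 2. $\Lambda$ is independent of $f_N$, i.e. constant in the $(1/f_N)$-direction; 3. $\Lambda$ is increasing in every $q_n$-direction, $1\le n\le N$; 4. for $1\le n\le N$, on every interval in $\mathcal D$ in the $w_n$-direction, $\Lambda$ is decreasing on the set of points where $\Lambda>0$ and increasing on the set of points where $\Lambda<0$. -/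

import Mathlib

namespace DiscreteSL

/-- Real discrete Sturm-Liouville equations `(1/f, q, w)`, with the topology of `ℝ^(3N+1)`.
The first component is the sequence `1/f_0, ..., 1/f_N`. Entry `i : Fin N` of the second and
third components stands for `q_(i+1)` and `w_(i+1)`, so these are `q_1, ..., q_N` and
`w_1, ..., w_N`. -/
abbrev SLE (N : ℕ) : Type :=
  (Fin (N + 1) → ℝ) × (Fin N → ℝ) × (Fin N → ℝ)

namespace SLE

variable {N : ℕ}

/-- The coordinate `1/f_n`, `0 ≤ n ≤ N`. -/
def invF (ω : SLE N) (n : Fin (N + 1)) : ℝ := ω.1 n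

/-- The coefficient `f_n`, `0 ≤ n ≤ N`. -/
noncomputable def f (ω : SLE N) (n : Fin (N + 1)) : ℝ := (ω.invF n)⁻¹

/-- The coefficient `q_(i+1)`, `0 ≤ i ≤ N - 1`. -/
def q (ω : SLE N) (i : Fin N) : ℝ := ω.2.1 i

/-- The weight `w_(i+1)`, `0 ≤ i ≤ N - 1`. -/
def w (ω : SLE N) (i : Fin N) : ℝ := ω.2.2 i

/-- The equation obtained from `ω` by giving the coordinate `1/f_n` the value `t`. -/
def setInvF (ω : SLE N) (n : Fin (N + 1)) (t : ℝ) : SLE N :=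
  (Function.update ω.1 n t, ω.2.1, ω.2.2)

/-- The equation obtained from `ω` by giving the coordinate `q_(i+1)` the value `t`. -/
def setQ (ω : SLE N) (i : Fin N) (t : ℝ) : SLE N :=
  (ω.1, Function.update ω.2.1 i t, ω.2.2)

/-- The equation obtained from `ω` by giving the coordinate `w_(i+1)` the value `t`. -/
def setW (ω : SLE N) (i : Fin N) (t : ℝ) : SLE N :=
  (ω.1, ω.2.1, Function.update ω.2.2 i t)

/-- The forward difference `Δ y_n = y_(n+1) - y_n`, `0 ≤ n ≤ N`, of `y_0, ..., y_(N+1)`. -/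
def delta (y : Fin (N + 2) → ℂ) (n : Fin (N + 1)) : ℂ := y n.succ - y n.castSucc

/-- The quasi-difference `f_n Δ y_n`, `0 ≤ n ≤ N`. -/
noncomputable def quasi (ω : SLE N) (y : Fin (N + 2) → ℂ) (n : Fin (N + 1)) : ℂ :=
  (ω.f n : ℂ) * delta y n

/-- `y_0, ..., y_(N+1)` solves `-∇(f_n Δ y_n) + q_n y_n = lam w_n y_n` for `1 ≤ n ≤ N`.
With `n = i + 1`, `∇(f_n Δ y_n) = f_n Δ y_n - f_(n-1) Δ y_(n-1)` is
`quasi i.succ - quasi i.castSucc`, and `y_n` is `y i.succ.castSucc`. -/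
def IsSolution (ω : SLE N) (lam : ℂ) (y : Fin (N + 2) → ℂ) : Prop :=
  ∀ i : Fin N,
    -(ω.quasi y i.succ - ω.quasi y i.castSucc) + (ω.q i : ℂ) * y i.succ.castSucc
      = lam * (ω.w i : ℂ) * y i.succ.castSucc

/-- The boundary condition `A (y_0, f_0 Δ y_0)ᵗ + B (y_N, f_N Δ y_N)ᵗ = 0`. -/
def SatisfiesBC (ω : SLE N) (A B : Matrix (Fin 2) (Fin 2) ℂ) (y : Fin (N + 2) → ℂ) : Prop :=
  A.mulVec ![y 0, ω.quasi y 0]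
    + B.mulVec ![y (Fin.last N).castSucc, ω.quasi y (Fin.last N)] = 0

/-- `lam` is an eigenvalue of the problem given by the equation `ω` and the boundary condition
`[A | B]`. -/
def IsEigenvalue (ω : SLE N) (A B : Matrix (Fin 2) (Fin 2) ℂ) (lam : ℂ) : Prop :=
  ∃ y : Fin (N + 2) → ℂ, y ≠ 0 ∧ ω.IsSolution lam y ∧ ω.SatisfiesBC A B y

end SLE

/-- The equations with all `f_n` nonzero (`0 ≤ n ≤ N`) and all `w_n` positive (`1 ≤ n ≤ N`).
As `f_n` is recorded by its reciprocal, `f_n` is a nonzero real number exactly when the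
coordinate `1/f_n` is nonzero. -/
def omegaPlus (N : ℕ) : Set (SLE N) :=
  {ω | (∀ n, ω.invF n ≠ 0) ∧ ∀ i, 0 < ω.w i}

/-- The matrix `E` with rows `(0, 1)` and `(-1, 0)`. -/
def E : Matrix (Fin 2) (Fin 2) ℂ := !![0, 1; -1, 0]

/-- `(A, B)` represents a self-adjoint boundary condition `[A | B]`: `rank (A, B) = 2` and
`A E A* = B E B*`. -/
def IsSelfAdjointBC (A B : Matrix (Fin 2) (Fin 2) ℂ) : Prop :=
  (Matrix.fromCols A B).rank = 2 ∧ A * E * A.conjTranspose = B * E * B.conjTranspose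

/-- For the fixed boundary condition `[A | B]`, the function `Lam` on `D` is a continuous eigenvalue
branch over `omegaPlus N`: `D` is a connected (nonempty) open subset of `omegaPlus N`, itself open
in `ℝ^(3N+1)`, and `Lam` is a continuous real function on `D` whose value at each equation in `D`
is an eigenvalue of the problem. No restriction is made on multiplicities. -/
structure IsContinuousEigenvalueBranch {N : ℕ} (A B : Matrix (Fin 2) (Fin 2) ℂ)
    (D : Set (SLE N)) (Lam : SLE N → ℝ) : Prop where
  isOpen : IsOpen D
  isConnected : IsConnected D
  subset : D ⊆ omegaPlus N
  continuousOn : ContinuousOn Lam D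
  isEigenvalue : ∀ ω ∈ D, ω.IsEigenvalue A B (Lam ω : ℂ)

end DiscreteSL

open Filter Topology ComplexConjugate

/-! ### Self-adjoint boundary conditions and the boundary bracket -/

namespace DiscreteSL

/-! For eigenpairs `(lam, y)` of `ω` and `(mu, z)` of `ω'`, self-adjointness cancels the boundary
terms, and `lagrange_identity` expresses `mu - lam`, times a weighted product of `y` and `z`,
exactly through `ω' - ω`. Divide by the step along a line and let it shrink: normalized
eigenfunctions accumulate, by compactness, at an eigenfunction `y`, and the slopes of the branch at
the first variation over `∑ w |y|²` (`exists_tendsto_slope`). No simplicity of eigenvalues is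
needed. The first variation is `-|f_n Δ y_n|²` for `1/f_n` with `n < N`, zero for `1/f_N`, `|y_n|²`
for `q_n` and `-Λ |y_n|²` for `w_n`, which gives the signs. As the branch need not be
differentiable, `le_left_of_slope` deduces monotonicity from accumulation values of right slopes. -/

/-- The solutions of a self-adjoint boundary condition are parametrized by `ℂ²`. -/
theorem IsSelfAdjointBC.exists_param {A B : Matrix (Fin 2) (Fin 2) ℂ} (hAB : IsSelfAdjointBC A B)
    {u v : Fin 2 → ℂ} (h : A.mulVec u + B.mulVec v = 0) :
    ∃ c : Fin 2 → ℂ, u = (E * A.conjTranspose).mulVec c ∧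
      v = (-(E * B.conjTranspose)).mulVec c := by
  obtain ⟨hr, hE⟩ := hAB
  set M := Matrix.fromCols A B with hM
  set P := Matrix.fromRows (E * A.conjTranspose) (-(E * B.conjTranspose)) with hP
  have hPM : P = Matrix.fromBlocks E 0 0 (-E) * M.conjTranspose := by
    rw [hM, Matrix.conjTranspose_fromCols_eq_fromRows_conjTranspose, Matrix.fromBlocks_mul_fromRows]
    simp [hP]
  have hdet : IsUnit (Matrix.fromBlocks E 0 0 (-E)).det := by
    simp [Matrix.det_fromBlocks_zero₂₁, E, Matrix.det_fin_two]
  have hrP : P.rank = 2 := by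
    rw [hPM, Matrix.rank_mul_eq_right_of_isUnit_det _ _ hdet]
    open ComplexOrder in rw [Matrix.rank_conjTranspose, hr]
  -- `A E A* = B E B*` says `M * P = 0`; range and kernel both have dimension 2, so they coincide.
  have hle : LinearMap.range P.mulVecLin ≤ LinearMap.ker M.mulVecLin := by
    rintro _ ⟨c, rfl⟩
    have h0 : M * P = 0 := by
      rw [hM, hP, Matrix.fromCols_mul_fromRows, ← Matrix.mul_assoc, hE, Matrix.mul_neg,
        ← Matrix.mul_assoc, add_neg_cancel]
    simp [Matrix.mulVec_mulVec, h0]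
  have hker : Module.finrank ℂ (LinearMap.ker M.mulVecLin) = 2 := by
    have h1 := LinearMap.finrank_range_add_finrank_ker M.mulVecLin
    have h2 : Module.finrank ℂ (LinearMap.range M.mulVecLin) = 2 := hr
    rw [h2] at h1
    simp at h1
    omega
  have heq := Submodule.eq_of_le_of_finrank_eq hle (hrP.trans hker.symm)
  have hmem : Sum.elim u v ∈ LinearMap.ker M.mulVecLin := by
    rw [LinearMap.mem_ker, Matrix.mulVecLin_apply, hM, Matrix.fromCols_mulVec_sumElim, h]
  rw [← heq] at hmem
  obtain ⟨c, hc⟩ := hmem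
  rw [Matrix.mulVecLin_apply, hP, Matrix.fromRows_mulVec] at hc
  exact ⟨c, funext fun i => (congrFun hc (Sum.inl i)).symm,
    funext fun i => (congrFun hc (Sum.inr i)).symm⟩

/-- The left bracket is `u'* E u`. With `u = E A* c` and `u' = E A* c'` it becomes `c'* A E A* c`;
the right one is `c'* B E B* c`. -/
theorem IsSelfAdjointBC.bracket_eq {A B : Matrix (Fin 2) (Fin 2) ℂ} (hAB : IsSelfAdjointBC A B)
    {u v u' v' : Fin 2 → ℂ} (h : A.mulVec u + B.mulVec v = 0)
    (h' : A.mulVec u' + B.mulVec v' = 0) :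
    u 1 * conj (u' 0) - conj (u' 1) * u 0 = v 1 * conj (v' 0) - conj (v' 1) * v 0 := by
  obtain ⟨c, rfl, rfl⟩ := hAB.exists_param h
  obtain ⟨c', rfl, rfl⟩ := hAB.exists_param h'
  have hE := hAB.2
  have e00 := congrFun (congrFun hE 0) 0
  have e01 := congrFun (congrFun hE 0) 1
  have e10 := congrFun (congrFun hE 1) 0
  have e11 := congrFun (congrFun hE 1) 1
  simp [E, Matrix.mul_apply, Fin.sum_univ_two] at e00 e01 e10 e11
  simp only [E, Matrix.mulVec, dotProduct, Matrix.mul_apply, Matrix.neg_apply, Fin.sum_univ_two,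
    Matrix.conjTranspose_apply, Matrix.of_apply, Matrix.cons_val_zero, Matrix.cons_val_one,
    Matrix.cons_val', Matrix.cons_val_fin_one, map_add, map_mul, map_neg, map_zero, map_one,
    RCLike.star_def, Complex.conj_conj]
  linear_combination conj (c' 0) * c 0 * e00 + conj (c' 1) * c 0 * e10 +
    conj (c' 0) * c 1 * e01 + conj (c' 1) * c 1 * e11

theorem sum_succ_sub_castSucc {N : ℕ} (W : Fin (N + 1) → ℂ) :
    ∑ i : Fin N, (W i.succ - W i.castSucc) = W (Fin.last N) - W 0 := by
  have h := (Fin.sum_univ_succ W).symm.trans (Fin.sum_univ_castSucc W)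
  rw [Finset.sum_sub_distrib]
  linear_combination h

/-! ### Lagrange identity and positivity of the weight sum -/

namespace SLE

variable {N : ℕ}

theorem delta_eq {ω : SLE N} {n : Fin (N + 1)} (h : ω.invF n ≠ 0) (y : Fin (N + 2) → ℂ) :
    delta y n = ω.invF n * ω.quasi y n := by
  have h' : (ω.invF n : ℂ) ≠ 0 := by exact_mod_cast h
  simp [quasi, f, h']

/-- The weighted inner product over `1 ≤ n ≤ N`. -/
noncomputable def weightForm (ω : SLE N) (y z : Fin (N + 2) → ℂ) : ℂ :=
  ∑ i, (ω.w i : ℂ) * y i.succ.castSucc * conj (z i.succ.castSucc)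

/-- The first variation, in the direction `d`, of the form of the equation, evaluated
at solutions `y` and `z` of the equations `ω` and `ω'`. -/
noncomputable def variationForm (ω ω' : SLE N) (lam : ℝ) (d : SLE N)
    (y z : Fin (N + 2) → ℂ) : ℂ :=
  ∑ i : Fin N, (-((d.invF i.castSucc : ℂ) *
      (ω.quasi y i.castSucc * conj (ω'.quasi z i.castSucc))) +
    (d.q i - lam * d.w i : ℂ) * (y i.succ.castSucc * conj (z i.succ.castSucc)))

/-- Summation by parts: the bracket of `y` and `conj z` telescopes, and its end values agree by
`bracket_eq`. Writing `Δ y` as `1/f` times the quasi-difference makes the remainder linear in the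
coordinates, so the identity is exact, not just first order. -/
theorem lagrange_identity {ω ω' : SLE N} {lam mu : ℝ} {y z : Fin (N + 2) → ℂ}
    {A B : Matrix (Fin 2) (Fin 2) ℂ} (hAB : IsSelfAdjointBC A B)
    (hω : ∀ n, ω.invF n ≠ 0) (hω' : ∀ n, ω'.invF n ≠ 0)
    (hy : ω.IsSolution lam y) (hz : ω'.IsSolution mu z)
    (hyBC : ω.SatisfiesBC A B y) (hzBC : ω'.SatisfiesBC A B z) :
    (mu - lam : ℂ) * ω'.weightForm y z = variationForm ω ω' lam (ω' - ω) y z := by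
  have hb := hAB.bracket_eq hyBC hzBC
  have ht := sum_succ_sub_castSucc (fun n : Fin (N + 1) =>
    ω.quasi y n * conj (z n.castSucc) - conj (ω'.quasi z n) * y n.castSucc)
  have h0 : ∑ i : Fin N, ((ω.quasi y i.succ * conj (z i.succ.castSucc) -
      conj (ω'.quasi z i.succ) * y i.succ.castSucc) - (ω.quasi y i.castSucc *
      conj (z i.castSucc.castSucc) - conj (ω'.quasi z i.castSucc) * y i.castSucc.castSucc)) = 0 := by
    rw [ht]
    simp only [Matrix.cons_val_zero, Matrix.cons_val_one] at hb
    rw [sub_eq_zero]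
    simpa using hb.symm
  rw [weightForm, Finset.mul_sum, variationForm, ← sub_eq_zero, ← Finset.sum_sub_distrib, ← h0]
  refine Finset.sum_congr rfl fun i _ => ?_
  have e1 := hy i
  have e2 := congrArg conj (hz i)
  have d1 := delta_eq (hω i.castSucc) y
  have d2 := congrArg conj (delta_eq (hω' i.castSucc) z)
  simp only [delta, Fin.succ_castSucc, map_sub, map_mul, map_add, map_neg,
    Complex.conj_ofReal] at e1 e2 d1 d2
  have s1 : ((ω' - ω).invF i.castSucc : ℂ) = ω'.invF i.castSucc - ω.invF i.castSucc := by
    simp [invF]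
  have s2 : ((ω' - ω).q i : ℂ) = ω'.q i - ω.q i := by simp [q]
  have s3 : ((ω' - ω).w i : ℂ) = ω'.w i - ω.w i := by simp [w]
  rw [s1, s2, s3]
  linear_combination conj (z i.succ.castSucc) * e1 - y i.succ.castSucc * e2 +
    conj (ω'.quasi z i.castSucc) * d1 - ω.quasi y i.castSucc * d2

theorem variationForm_smul (ω ω' : SLE N) (lam c : ℝ) (d : SLE N) (y z : Fin (N + 2) → ℂ) :
    variationForm ω ω' lam (c • d) y z = c * variationForm ω ω' lam d y z := by
  rw [variationForm, variationForm, Finset.mul_sum]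
  refine Finset.sum_congr rfl fun i _ => ?_
  simp only [invF, q, w, Prod.smul_fst, Prod.smul_snd, Pi.smul_apply, smul_eq_mul,
    Complex.ofReal_mul]
  ring

/-- A solution vanishing at `1, ..., N` is trivial, as `N ≥ 2`. -/
theorem IsSolution.eq_zero {ω : SLE N} (hN : 2 ≤ N) (hω : ∀ n, ω.invF n ≠ 0) {lam : ℂ}
    {y : Fin (N + 2) → ℂ} (hy : ω.IsSolution lam y) (h : ∀ i : Fin N, y i.succ.castSucc = 0) :
    y = 0 := by
  obtain ⟨m, rfl⟩ := Nat.exists_eq_add_of_le' hN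
  have hf : ∀ n, (ω.f n : ℂ) ≠ 0 := fun n => by
    exact_mod_cast inv_ne_zero (hω n)
  -- The equations at `n = 1` and `n = N` reduce to `f_0 y_0 = 0` and `f_N y_(N+1) = 0`, since `y_2`
  -- and `y_(N-1)` are among the vanishing values.
  have e0 := hy 0
  have e1 := hy (Fin.last (m + 1))
  have a0 := h 0
  have a1 := h 1
  have b0 := h (Fin.last (m + 1))
  have b1 := h (Fin.last m).castSucc
  simp only [h, quasi, delta] at e0 e1
  have c1 : y (Fin.succ (Fin.succ (0 : Fin (m + 2)))) = 0 := a1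
  have c0 : y (Fin.succ (Fin.castSucc (0 : Fin (m + 2)))) = 0 := a0
  have c2 : y (Fin.castSucc (Fin.castSucc (Fin.last (m + 1)))) = 0 := b1
  have c3 : y (Fin.succ (Fin.castSucc (Fin.last (m + 1)))) = 0 := b0
  rw [c0, c1] at e0
  rw [c2, c3] at e1
  have y0 : y 0 = 0 := by simpa [hf] using e0
  have yN : y (Fin.last (m + 3)) = 0 := by simpa [hf] using e1
  funext n
  refine Fin.lastCases ?_ (fun k => ?_) n
  · exact yN
  · refine Fin.cases ?_ (fun i => ?_) k
    · exact y0
    · exact h i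

theorem weightForm_self (ω : SLE N) (y : Fin (N + 2) → ℂ) :
    ω.weightForm y y = ((∑ i, ω.w i * Complex.normSq (y i.succ.castSucc) : ℝ) : ℂ) := by
  simp [weightForm, mul_assoc, Complex.mul_conj]

theorem variationForm_self (ω : SLE N) (lam : ℝ) (d : SLE N) (y : Fin (N + 2) → ℂ) :
    variationForm ω ω lam d y y =
      ((∑ i : Fin N, (-(d.invF i.castSucc * Complex.normSq (ω.quasi y i.castSucc)) +
        (d.q i - lam * d.w i) * Complex.normSq (y i.succ.castSucc)) : ℝ) : ℂ) := by
  simp [variationForm, Complex.mul_conj]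

/-- The sum omits `y_0` and `y_(N+1)`, so positivity rests on `IsSolution.eq_zero`. -/
theorem IsSolution.weight_pos {ω : SLE N} (hN : 2 ≤ N) (hω : ω ∈ omegaPlus N) {lam : ℂ}
    {y : Fin (N + 2) → ℂ} (hy : ω.IsSolution lam y) (h : y ≠ 0) :
    0 < ∑ i, ω.w i * Complex.normSq (y i.succ.castSucc) := by
  refine Finset.sum_pos' (fun i _ => mul_nonneg (hω.2 i).le (Complex.normSq_nonneg _)) ?_
  by_contra! hc
  refine h (hy.eq_zero hN hω.1 fun i => ?_)
  by_contra hi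
  exact absurd (hc i (Finset.mem_univ i))
    (not_le.2 (mul_pos (hω.2 i) (Complex.normSq_pos.2 hi)))

/-! ### Limits of solutions under perturbation of the equation -/

section Limits

variable {α : Type*} {l : Filter α} {ω : SLE N} {η : α → SLE N} {lam : ℝ} {mu : α → ℝ}
  {y : Fin (N + 2) → ℂ} {z : α → Fin (N + 2) → ℂ}

theorem tendsto_invF (hη : Tendsto η l (𝓝 ω)) (n : Fin (N + 1)) :
    Tendsto (fun a => (η a).invF n) l (𝓝 (ω.invF n)) :=
  (((continuous_apply n).comp continuous_fst).tendsto ω).comp hη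

theorem tendsto_q (hη : Tendsto η l (𝓝 ω)) (i : Fin N) :
    Tendsto (fun a => (((η a).q i : ℝ) : ℂ)) l (𝓝 (ω.q i)) :=
  (Complex.continuous_ofReal.tendsto _).comp
    ((((continuous_apply i).comp (continuous_fst.comp continuous_snd)).tendsto ω).comp hη)

theorem tendsto_w (hη : Tendsto η l (𝓝 ω)) (i : Fin N) :
    Tendsto (fun a => (((η a).w i : ℝ) : ℂ)) l (𝓝 (ω.w i)) :=
  (Complex.continuous_ofReal.tendsto _).comp
    ((((continuous_apply i).comp (continuous_snd.comp continuous_snd)).tendsto ω).comp hη)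

theorem tendsto_quasi (hω : ∀ n, ω.invF n ≠ 0) (hη : Tendsto η l (𝓝 ω))
    (hz : Tendsto z l (𝓝 y)) (n : Fin (N + 1)) :
    Tendsto (fun a => (η a).quasi (z a) n) l (𝓝 (ω.quasi y n)) :=
  ((Complex.continuous_ofReal.tendsto _).comp ((tendsto_invF hη n).inv₀ (hω n))).mul
    ((tendsto_pi_nhds.1 hz _).sub (tendsto_pi_nhds.1 hz _))

theorem tendsto_weightForm (hη : Tendsto η l (𝓝 ω)) (hz : Tendsto z l (𝓝 y)) :
    Tendsto (fun a => (η a).weightForm y (z a)) l (𝓝 (ω.weightForm y y)) :=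
  tendsto_finsetSum _ fun i _ => ((tendsto_w hη i).mul tendsto_const_nhds).mul
    ((Complex.continuous_conj.tendsto _).comp (tendsto_pi_nhds.1 hz _))

theorem tendsto_variationForm (hω : ∀ n, ω.invF n ≠ 0) (hη : Tendsto η l (𝓝 ω))
    (hz : Tendsto z l (𝓝 y)) (d : SLE N) :
    Tendsto (fun a => variationForm ω (η a) lam d y (z a)) l
      (𝓝 (variationForm ω ω lam d y y)) :=
  tendsto_finsetSum _ fun _ _ =>
    ((tendsto_const_nhds.mul (tendsto_const_nhds.mul ((Complex.continuous_conj.tendsto _).comp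
      (tendsto_quasi hω hη hz _)))).neg).add (tendsto_const_nhds.mul
        (tendsto_const_nhds.mul ((Complex.continuous_conj.tendsto _).comp
          (tendsto_pi_nhds.1 hz _))))

theorem isSolution_of_tendsto [l.NeBot] (hω : ∀ n, ω.invF n ≠ 0) (hη : Tendsto η l (𝓝 ω))
    (hmu : Tendsto mu l (𝓝 lam)) (hz : Tendsto z l (𝓝 y))
    (h : ∀ᶠ a in l, (η a).IsSolution (mu a) (z a)) : ω.IsSolution lam y := by
  intro i
  have hyi := tendsto_pi_nhds.1 hz i.succ.castSucc
  refine tendsto_nhds_unique_of_eventuallyEq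
    ((((tendsto_quasi hω hη hz _).sub (tendsto_quasi hω hη hz _)).neg).add
      ((tendsto_q hη i).mul hyi))
    ((((Complex.continuous_ofReal.tendsto _).comp hmu).mul (tendsto_w hη i)).mul hyi) ?_
  filter_upwards [h] with a ha using ha i

theorem satisfiesBC_of_tendsto [l.NeBot] {A B : Matrix (Fin 2) (Fin 2) ℂ}
    (hω : ∀ n, ω.invF n ≠ 0) (hη : Tendsto η l (𝓝 ω)) (hz : Tendsto z l (𝓝 y))
    (h : ∀ᶠ a in l, (η a).SatisfiesBC A B (z a)) : ω.SatisfiesBC A B y := by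
  have key : ∀ (C : Matrix (Fin 2) (Fin 2) ℂ) (k : Fin (N + 2)) (n : Fin (N + 1)),
      Tendsto (fun a => C.mulVec ![z a k, (η a).quasi (z a) n]) l
        (𝓝 (C.mulVec ![y k, ω.quasi y n])) := by
    intro C k n
    refine ((Continuous.matrix_mulVec continuous_const continuous_id).tendsto _).comp ?_
    refine tendsto_pi_nhds.2 fun j => ?_
    fin_cases j
    · exact tendsto_pi_nhds.1 hz k
    · exact tendsto_quasi hω hη hz n
  refine tendsto_nhds_unique_of_eventuallyEq ((key A _ _).add (key B _ _))
    tendsto_const_nhds ?_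
  filter_upwards [h] with a ha using ha

end Limits

theorem IsEigenvalue.exists_norm_eq_one {ω : SLE N} {A B : Matrix (Fin 2) (Fin 2) ℂ} {lam : ℂ}
    (h : ω.IsEigenvalue A B lam) :
    ∃ y ∈ Metric.sphere (0 : Fin (N + 2) → ℂ) 1, ω.IsSolution lam y ∧ ω.SatisfiesBC A B y := by
  obtain ⟨y, hy0, hy, hBC⟩ := h
  set c : ℂ := ((‖y‖⁻¹ : ℝ) : ℂ) with hc
  have hq : ∀ n, ω.quasi (c • y) n = c * ω.quasi y n := fun n => by
    simp [quasi, delta]; ring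
  refine ⟨c • y, ?_, fun i => ?_, ?_⟩
  · simp [hc, norm_smul, hy0]
  · simp only [hq, Pi.smul_apply, smul_eq_mul]
    linear_combination c * hy i
  · have hv : ∀ k n, ![(c • y) k, ω.quasi (c • y) n] = c • ![y k, ω.quasi y n] := fun k n => by
      ext j; fin_cases j <;> simp [hq]
    rw [SatisfiesBC, hv, hv, Matrix.mulVec_smul, Matrix.mulVec_smul, ← smul_add,
      show A.mulVec _ + B.mulVec _ = 0 from hBC, smul_zero]

/-! ### Slopes of a branch and monotonicity -/

/-- Along a line of direction `d`, the difference quotients of an eigenvalue that is continuous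
at `x` accumulate at a value given by the first variation at an eigenfunction. -/
theorem exists_tendsto_slope (hN : 2 ≤ N) {A B : Matrix (Fin 2) (Fin 2) ℂ}
    (hAB : IsSelfAdjointBC A B) {η : ℝ → SLE N} {mu : ℝ → ℝ} {d : SLE N} {x : ℝ}
    (hx : η x ∈ omegaPlus N) (hline : ∀ t, η t - η x = (t - x) • d)
    (l : Ultrafilter ℝ) (hl : (l : Filter ℝ) ≤ 𝓝[≠] x)
    (hD : ∀ᶠ t in l, η t ∈ omegaPlus N ∧ (η t).IsEigenvalue A B (mu t))
    (hmu : Tendsto mu l (𝓝 (mu x))) :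
    ∃ (y : Fin (N + 2) → ℂ) (S : ℝ), 0 < S ∧ Tendsto (slope mu x) l
      (𝓝 ((∑ i : Fin N, (-(d.invF i.castSucc * Complex.normSq ((η x).quasi y i.castSucc)) +
        (d.q i - mu x * d.w i) * Complex.normSq (y i.succ.castSucc))) / S)) := by
  have hη : Tendsto η l (𝓝 (η x)) := by
    have h1 : η = fun t => η x + (t - x) • d := by
      funext t; rw [← hline]; abel
    have h2 : Continuous fun t : ℝ => η x + (t - x) • d := by fun_prop
    rw [← h1] at h2
    exact (h2.tendsto x).mono_left (hl.trans nhdsWithin_le_nhds)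
  -- An arbitrary unit vector serves where `mu t` is not an eigenvalue, so that `z` is total with
  -- values in a compact set and converges along the ultrafilter.
  have hex : ∀ t, ∃ z ∈ Metric.sphere (0 : Fin (N + 2) → ℂ) 1, (η t).IsEigenvalue A B (mu t) →
      (η t).IsSolution (mu t) z ∧ (η t).SatisfiesBC A B z := by
    intro t
    by_cases h : (η t).IsEigenvalue A B (mu t)
    · obtain ⟨z, hz, h'⟩ := h.exists_norm_eq_one
      exact ⟨z, hz, fun _ => h'⟩
    · obtain ⟨z, hz⟩ := NormedSpace.sphere_nonempty (E := Fin (N + 2) → ℂ) (x := 0) (r := 1) |>.2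
        zero_le_one
      exact ⟨z, hz, fun h' => absurd h' h⟩
  choose z hzs hz using hex
  obtain ⟨y, hys, hzy⟩ := (isCompact_sphere (0 : Fin (N + 2) → ℂ) 1).ultrafilter_le_nhds'
    (l.map z) (mem_map.2 (Filter.univ_mem' hzs))
  replace hzy : Tendsto z l (𝓝 y) := hzy
  have hy0 : y ≠ 0 := by
    rintro rfl
    simp at hys
  have hsol : (η x).IsSolution (mu x) y := isSolution_of_tendsto hx.1 hη hmu hzy
    (hD.mono fun t ht => (hz t ht.2).1)
  have hBC : (η x).SatisfiesBC A B y := satisfiesBC_of_tendsto hx.1 hη hzy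
    (hD.mono fun t ht => (hz t ht.2).2)
  have hS := hsol.weight_pos hN hx hy0
  refine ⟨y, _, hS, ?_⟩
  have hW := tendsto_weightForm hη hzy
  have hV := tendsto_variationForm (lam := mu x) hx.1 hη hzy d
  rw [weightForm_self] at hW
  rw [variationForm_self] at hV
  have hS' : ((∑ i, (η x).w i * Complex.normSq (y i.succ.castSucc) : ℝ) : ℂ) ≠ 0 := by
    exact_mod_cast hS.ne'
  have hlim := (Complex.continuous_re.tendsto _).comp (hV.div hW hS')
  rw [← Complex.ofReal_div, Complex.ofReal_re] at hlim
  refine hlim.congr' ?_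
  filter_upwards [hD, hl self_mem_nhdsWithin, hW.eventually_ne hS'] with t ht htx hWt
  have hL := lagrange_identity hAB hx.1 ht.1.1 hsol (hz t ht.2).1 hBC (hz t ht.2).2
  rw [hline, variationForm_smul] at hL
  have htx' : ((t - x : ℝ) : ℂ) ≠ 0 := by
    exact_mod_cast sub_ne_zero.2 htx
  have : variationForm (η x) (η t) (mu x) d y (z t) / (η t).weightForm y (z t) =
      ((slope mu x t : ℝ) : ℂ) := by
    rw [slope_def_field, Complex.ofReal_div, div_eq_div_iff hWt htx', Complex.ofReal_sub (mu t),
      hL, mul_comm]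
  simp only [Function.comp_apply, Pi.div_apply, this, Complex.ofReal_re]

end SLE

/-- A continuous function on `[a, b]` whose right difference quotients have a nonpositive
accumulation value wherever the function is at least `g a` satisfies `g b ≤ g a`. -/
theorem le_left_of_slope {g : ℝ → ℝ} {a b : ℝ} (hab : a ≤ b) (hg : ContinuousOn g (Set.Icc a b))
    (h : ∀ x ∈ Set.Ico a b, ∃ L, (g a ≤ g x → L ≤ 0) ∧
      ∀ r, L < r → ∃ᶠ t in 𝓝[>] x, slope g x t < r) :
    g b ≤ g a := by
  have key : ∀ δ > 0, g b ≤ g a + δ * (b - a) := by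
    intro δ hδ
    have h' : ∀ x, ∃ L, x ∈ Set.Ico a b → (g a ≤ g x → L ≤ 0) ∧
        ∀ r, L < r → ∃ᶠ t in 𝓝[>] x, slope g x t < r := fun x => by
      by_cases hx : x ∈ Set.Ico a b
      · obtain ⟨L, hL⟩ := h x hx
        exact ⟨L, fun _ => hL⟩
      · exact ⟨0, fun hx' => absurd hx' hx⟩
    choose g' hg' using h'
    -- The barrier is a line of slope `δ > 0` through `(a, g a)`. Where `g` meets it, `g x ≥ g a`,
    -- so the slope hypothesis is needed only there.
    refine image_le_of_liminf_slope_right_lt_deriv_boundary (f' := g')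
      (B := fun x => g a + δ * (x - a)) (B' := fun _ => δ) hg (fun x hx => (hg' x hx).2)
      (by simp) (fun x => ?_) (fun x hx hxB => ?_) (Set.right_mem_Icc.2 hab)
    · simpa using (((hasDerivAt_id x).sub_const a).const_mul δ).const_add (g a)
    · refine ((hg' x hx).1 ?_).trans_lt hδ
      rw [hxB]
      exact le_add_of_nonneg_right (mul_nonneg hδ.le (sub_nonneg.2 hx.1))
  have hlim : Tendsto (fun δ => g a + δ * (b - a)) (𝓝[>] 0) (𝓝 (g a + 0 * (b - a))) :=
    (Continuous.tendsto (by fun_prop) _).mono_left nhdsWithin_le_nhds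
  rw [zero_mul, add_zero] at hlim
  exact ge_of_tendsto hlim (eventually_nhdsWithin_of_forall key)

/-- `σ * Λ` does not increase along a segment of direction `d`, provided that its first variation
is nonpositive wherever `σ * Λ` is at least its initial value. -/
theorem IsContinuousEigenvalueBranch.le_along {N : ℕ} (hN : 2 ≤ N)
    {A B : Matrix (Fin 2) (Fin 2) ℂ} (hAB : IsSelfAdjointBC A B) {D : Set (SLE N)}
    {Lam : SLE N → ℝ} (hLam : IsContinuousEigenvalueBranch A B D Lam)
    {η : ℝ → SLE N} {d : SLE N} (hline : ∀ s t, η t - η s = (t - s) • d)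
    {a b : ℝ} (hab : a ≤ b) (hD : ∀ t ∈ Set.Icc a b, η t ∈ D) (σ : ℝ)
    (hσ : ∀ x ∈ Set.Icc a b, σ * Lam (η a) ≤ σ * Lam (η x) → ∀ y : Fin (N + 2) → ℂ,
      σ * ∑ i : Fin N, (-(d.invF i.castSucc * Complex.normSq ((η x).quasi y i.castSucc)) +
        (d.q i - Lam (η x) * d.w i) * Complex.normSq (y i.succ.castSucc)) ≤ 0) :
    σ * Lam (η b) ≤ σ * Lam (η a) := by
  have hη : Continuous η := by
    have h1 : η = fun t => η 0 + t • d := by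
      funext t
      have := hline 0 t
      rw [sub_zero] at this
      rw [← this]; abel
    rw [h1]; fun_prop
  have hc : ContinuousOn (fun t => Lam (η t)) (Set.Icc a b) :=
    hLam.continuousOn.comp hη.continuousOn hD
  refine le_left_of_slope (g := fun t => σ * Lam (η t)) hab (continuousOn_const.mul hc)
    fun x hx => ?_
  have hx' := Set.Ico_subset_Icc_self hx
  -- A limit along one ultrafilter finer than `𝓝[>] x` gives a frequent bound on right slopes, which
  -- is enough.
  set l : Ultrafilter ℝ := Ultrafilter.of (𝓝[>] x)
  have hl : (l : Filter ℝ) ≤ 𝓝[>] x := Ultrafilter.of_le _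
  have hmem : ∀ᶠ t in l, t ∈ Set.Icc a b := hl (Icc_mem_nhdsGT_of_mem hx)
  obtain ⟨y, S, hS, hlim⟩ := SLE.exists_tendsto_slope hN hAB (η := η) (mu := fun t => Lam (η t))
    (hLam.subset (hD x hx')) (hline x) l
    (hl.trans (nhdsWithin_mono _ fun t ht => ne_of_gt ht))
    (hmem.mono fun t ht => ⟨hLam.subset (hD t ht), hLam.isEigenvalue _ (hD t ht)⟩)
    ((hc x hx').mono_left (hl.trans
      (le_inf (nhdsWithin_le_nhds) (le_principal_iff.2 (Icc_mem_nhdsGT_of_mem hx)))))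
  refine ⟨_, fun hax => ?_, fun r hr =>
    (((hlim.const_mul σ).eventually_lt_const hr).mono fun t ht => ?_).frequently.filter_mono hl⟩
  · rw [← mul_div_assoc]
    exact div_nonpos_of_nonpos_of_nonneg (hσ x hx' hax y) hS.le
  · refine lt_of_eq_of_lt ?_ ht
    simp only [slope_def_field]
    ring

/-! ### Coordinate directions and the main theorem -/

section Directions

variable {N : ℕ} (ω : SLE N)

theorem SLE.setInvF_sub (n : Fin (N + 1)) (s t : ℝ) :
    ω.setInvF n t - ω.setInvF n s = (t - s) • ((Pi.single n 1, 0, 0) : SLE N) := by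
  refine Prod.ext (funext fun k => ?_) (Prod.ext (by simp [SLE.setInvF]) (by simp [SLE.setInvF]))
  by_cases h : k = n
  · subst h; simp [SLE.setInvF]
  · simp [SLE.setInvF, h]

theorem SLE.setQ_sub (n : Fin N) (s t : ℝ) :
    ω.setQ n t - ω.setQ n s = (t - s) • ((0, Pi.single n 1, 0) : SLE N) := by
  refine Prod.ext (by simp [SLE.setQ]) (Prod.ext (funext fun k => ?_) (by simp [SLE.setQ]))
  by_cases h : k = n
  · subst h; simp [SLE.setQ]
  · simp [SLE.setQ, h]

theorem SLE.setW_sub (n : Fin N) (s t : ℝ) :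
    ω.setW n t - ω.setW n s = (t - s) • ((0, 0, Pi.single n 1) : SLE N) := by
  refine Prod.ext (by simp [SLE.setW]) (Prod.ext (by simp [SLE.setW]) (funext fun k => ?_))
  by_cases h : k = n
  · subst h; simp [SLE.setW]
  · simp [SLE.setW, h]

end Directions

end DiscreteSL

/-- Along each coordinate line, `I` is an interval of values of the moving coordinate for which the
line stays in the domain `D` of the branch. -/
theorem theorem4p8 (N : ℕ) (hN : 2 ≤ N) (A B : Matrix (Fin 2) (Fin 2) ℂ)
    (hAB : DiscreteSL.IsSelfAdjointBC A B)
    (D : Set (DiscreteSL.SLE N)) (Lam : DiscreteSL.SLE N → ℝ)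
    (hLam : DiscreteSL.IsContinuousEigenvalueBranch A B D Lam) :
    -- decreasing in every `1/f_n`-direction, `0 ≤ n ≤ N - 1`
    (∀ (n : Fin (N + 1)), n ≠ Fin.last N → ∀ (ω : DiscreteSL.SLE N) (I : Set ℝ),
      I.OrdConnected → (∀ t ∈ I, ω.setInvF n t ∈ D) →
        AntitoneOn (fun t => Lam (ω.setInvF n t)) I) ∧
    -- independent of `f_N`
    (∀ (ω : DiscreteSL.SLE N) (I : Set ℝ),
      I.OrdConnected → (∀ t ∈ I, ω.setInvF (Fin.last N) t ∈ D) →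
        ∀ s ∈ I, ∀ t ∈ I, Lam (ω.setInvF (Fin.last N) s) = Lam (ω.setInvF (Fin.last N) t)) ∧
    -- increasing in every `q_n`-direction, `1 ≤ n ≤ N`
    (∀ (i : Fin N) (ω : DiscreteSL.SLE N) (I : Set ℝ),
      I.OrdConnected → (∀ t ∈ I, ω.setQ i t ∈ D) →
        MonotoneOn (fun t => Lam (ω.setQ i t)) I) ∧
    -- the positive parts are decreasing and the negative parts are increasing in every
    -- `w_n`-direction, `1 ≤ n ≤ N`
    (∀ (i : Fin N) (ω : DiscreteSL.SLE N) (I : Set ℝ),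
      I.OrdConnected → (∀ t ∈ I, ω.setW i t ∈ D) →
        AntitoneOn (fun t => Lam (ω.setW i t)) {t | t ∈ I ∧ 0 < Lam (ω.setW i t)} ∧
        MonotoneOn (fun t => Lam (ω.setW i t)) {t | t ∈ I ∧ Lam (ω.setW i t) < 0}) := by
  have single_nonneg : ∀ {m : ℕ} (n k : Fin m), (0 : ℝ) ≤ Pi.single (M := fun _ => ℝ) n 1 k :=
    fun n k => (Pi.single_nonneg (α := fun _ => ℝ)).2 zero_le_one k
  have invF_antitone : ∀ (n : Fin (N + 1)) (ω : DiscreteSL.SLE N) (I : Set ℝ),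
      I.OrdConnected → (∀ t ∈ I, ω.setInvF n t ∈ D) →
        AntitoneOn (fun t => Lam (ω.setInvF n t)) I := by
    intro n ω I hI hD s hs t ht hst
    have h := hLam.le_along hN hAB (ω.setInvF_sub n) hst
      (fun x hx => hD x (hI.out hs ht hx)) 1 fun x _ _ y => ?_
    · simpa using h
    · rw [one_mul]
      refine Finset.sum_nonpos fun i _ => ?_
      simpa [DiscreteSL.SLE.invF, DiscreteSL.SLE.q, DiscreteSL.SLE.w] using
        mul_nonneg (single_nonneg n i.castSucc) (Complex.normSq_nonneg _)
  refine ⟨fun n _ => invF_antitone n, ?_, ?_, ?_⟩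
  · intro ω I hI hD
    have hle : ∀ s ∈ I, ∀ t ∈ I, s ≤ t →
        Lam (ω.setInvF (Fin.last N) s) = Lam (ω.setInvF (Fin.last N) t) := by
      intro s hs t ht hst
      refine le_antisymm ?_ (invF_antitone _ ω I hI hD hs ht hst)
      have h := hLam.le_along hN hAB (ω.setInvF_sub (Fin.last N)) hst
        (fun x hx => hD x (hI.out hs ht hx)) (-1) fun x _ _ y => ?_
      · simpa using h
      -- The variation involves only `1/f_0, ..., 1/f_(N-1)`, hence vanishes in this direction and
      -- `σ = -1` is allowed too.
      · simp [DiscreteSL.SLE.invF, DiscreteSL.SLE.q, DiscreteSL.SLE.w, (Fin.castSucc_lt_last _).ne]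
    intro s hs t ht
    rcases le_total s t with hst | hst
    · exact hle s hs t ht hst
    · exact (hle t ht s hs hst).symm
  · intro i ω I hI hD s hs t ht hst
    have h := hLam.le_along hN hAB (ω.setQ_sub i) hst
      (fun x hx => hD x (hI.out hs ht hx)) (-1) fun x _ _ y => ?_
    · simpa using h
    · rw [neg_one_mul, neg_nonpos]
      refine Finset.sum_nonneg fun k _ => ?_
      simpa [DiscreteSL.SLE.invF, DiscreteSL.SLE.q, DiscreteSL.SLE.w] using
        mul_nonneg (single_nonneg i k) (Complex.normSq_nonneg _)
  · intro i ω I hI hD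
    constructor
    · rintro s ⟨hs, hs0⟩ t ⟨ht, -⟩ hst
      have h := hLam.le_along hN hAB (ω.setW_sub i) hst
        (fun x hx => hD x (hI.out hs ht hx)) 1 fun x _ hx y => ?_
      · simpa using h
      -- The set where `Λ > 0` need not be an interval. The sign is needed only where `Λ` is at
      -- least its value at `s`, which is positive.
      · rw [one_mul] at hx ⊢
        refine Finset.sum_nonpos fun k _ => ?_
        simpa [DiscreteSL.SLE.invF, DiscreteSL.SLE.q, DiscreteSL.SLE.w] using
          mul_nonneg (mul_nonneg (hs0.le.trans (by simpa using hx)) (single_nonneg i k))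
            (Complex.normSq_nonneg _)
    · rintro s ⟨hs, hs0⟩ t ⟨ht, -⟩ hst
      have h := hLam.le_along hN hAB (ω.setW_sub i) hst
        (fun x hx => hD x (hI.out hs ht hx)) (-1) fun x _ hx y => ?_
      · simpa using h
      · rw [neg_one_mul, neg_nonpos]
        rw [neg_one_mul, neg_one_mul, neg_le_neg_iff] at hx
        refine Finset.sum_nonneg fun k _ => ?_
        simpa [DiscreteSL.SLE.invF, DiscreteSL.SLE.q, DiscreteSL.SLE.w] using
          mul_nonneg (mul_nonneg (neg_nonneg.2 (hx.trans hs0.le)) (single_nonneg i k))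
            (Complex.normSq_nonneg _)
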